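/- Let $G$ be a finite simple undirected graph on $n \ge 1$ vertices. For $l \in \mathbb{N}$, an $l$-encoding of $G$ is an injection $\phi : V(G) \to \mathbb{N}^l$ such that for all $u, v \in V(G)$, $\{u,v\} \in E(G)$ if and only if $\phi(u)$ and $\phi(v)$ differ in all $l$ coordinates; the product dimension $\mathrm{pdim}(G)$ is the minimum $l$ for which $G$ has an $l$-encoding (equivalently, for which $G$ is an induced subgraph of a direct product of $l$ complete graphs). A tree decomposition of $G$ is a finite tree $T$ with node set $I$ together with subsets $X_i \subseteq V(G)$, $i \in I$, such that $\bigcup_{i \in I} X_i = V(G)$, every edge of $G$ has both ends in some $X_i$, and $X_i \cap X_k \subseteq X_j$ whenever $j$ lies on the path in $T$ from $i$ to $k$; its width is $\max_{i \in I} |X_i| - 1$, and the treewidth $\mathrm{tw}(G)$ is the minimum width over all tree decompositions of $G$. If $\mathrm{tw}(G) = t$, then $\mathrm{pdim}(G) \le (t+2)(\log_2 n + 1)$. -/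

import Mathlib

namespace SimpleGraph

universe u

/-- An `l`-encoding of `G`: an injection `φ : V → ℕ^l` such that two vertices are adjacent
if and only if their codes differ in all `l` coordinates. -/
def IsEncoding {V : Type u} (G : SimpleGraph V) (l : ℕ) (φ : V → Fin l → ℕ) : Prop :=
  Function.Injective φ ∧ ∀ a b : V, G.Adj a b ↔ ∀ i : Fin l, φ a i ≠ φ b i

/-- The product dimension of `G`: the minimum `l` such that an `l`-encoding of `G` exists.
For finite graphs the minimum is over a nonempty set, see `exists_isEncoding_pdim`. -/
noncomputable def pdim {V : Type u} (G : SimpleGraph V) : ℕ :=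
  sInf {l : ℕ | ∃ φ : V → Fin l → ℕ, G.IsEncoding l φ}

/-- A tree decomposition of `G`: a finite tree with a bag of vertices at each node, such that
the bags cover the vertices and the edges, and every bag on the path of the tree from `i` to `k`
contains the intersection of the bags at `i` and `k`. -/
structure TreeDecomposition {V : Type u} (G : SimpleGraph V) where
  /-- the nodes of the tree -/
  I : Type
  [fintypeI : Fintype I]
  /-- the tree -/
  T : SimpleGraph I
  /-- the bags -/
  bag : I → Finset V
  isTree : T.IsTree
  exists_mem_bag : ∀ v : V, ∃ i, v ∈ bag i
  exists_adj_mem_bag : ∀ a b : V, G.Adj a b → ∃ i, a ∈ bag i ∧ b ∈ bag i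
  mem_bag_of_mem_path : ∀ (i j k : I) (p : T.Walk i k), p.IsPath → j ∈ p.support →
    ∀ v : V, v ∈ bag i → v ∈ bag k → v ∈ bag j

attribute [instance] TreeDecomposition.fintypeI

/-- The width of a tree decomposition: the maximum size of a bag, minus one. It is an integer,
so that the empty graph has a decomposition of width `-1`. -/
def TreeDecomposition.width {V : Type u} {G : SimpleGraph V} (D : G.TreeDecomposition) : ℤ :=
  ((Finset.univ.sup fun i : D.I => (D.bag i).card : ℕ) : ℤ) - 1

/-- The treewidth of `G`: the minimum width of a tree decomposition of `G`.
For finite graphs the minimum is attained, see `exists_width_eq_treewidth`. -/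
noncomputable def treewidth {V : Type u} (G : SimpleGraph V) : ℤ :=
  sInf (Set.range fun D : G.TreeDecomposition => D.width)

/-- Every finite graph has an encoding with as many coordinates as its product dimension. -/
theorem exists_isEncoding_pdim {V : Type u} [Finite V] (G : SimpleGraph V) :
    ∃ φ : V → Fin G.pdim → ℕ, G.IsEncoding G.pdim φ := by
  classical
  have key : {l : ℕ | ∃ φ : V → Fin l → ℕ, G.IsEncoding l φ}.Nonempty := by
    obtain ⟨e⟩ : Nonempty (V ≃ Fin (Nat.card V)) := ⟨Finite.equivFin V⟩
    let P := Option {q : V × V // ¬ G.Adj q.1 q.2}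
    let g : P ≃ Fin (Nat.card P) := Finite.equivFin P
    -- one injective coordinate, and one coordinate merging each nonadjacent pair
    let c : V → P → ℕ := fun x o => match o with
      | none => (e x : ℕ)
      | some q => if x = q.1.2 then (e q.1.1 : ℕ) else (e x : ℕ)
    have he : ∀ x y : V, (e x : ℕ) = (e y : ℕ) → x = y := fun x y h =>
      e.injective (Fin.ext h)
    refine ⟨Nat.card P, fun x i => c x (g.symm i), ?_, ?_⟩
    · intro x y h
      have h1 := congrFun h (g none)
      simp only [Equiv.symm_apply_apply] at h1
      exact he x y h1
    · intro a b
      constructor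
      · intro hab i heq
        change c a (g.symm i) = c b (g.symm i) at heq
        rcases hq : g.symm i with _ | ⟨⟨p, q⟩, hpq⟩
        · rw [hq] at heq
          exact hab.ne (he a b heq)
        · rw [hq] at heq
          simp only [c] at heq
          split_ifs at heq with h1 h2 h2
          · exact hab.ne (h1.trans h2.symm)
          · exact hpq (by rw [he _ _ heq]; exact h1 ▸ hab.symm)
          · exact hpq (by rw [← he _ _ heq]; exact h2 ▸ hab)
          · exact hab.ne (he _ _ heq)
      · intro h
        by_contra hab
        apply h (g (some ⟨(a, b), hab⟩))
        simp [c]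
  exact Nat.sInf_mem key

/-- Every finite graph has a tree decomposition whose width is its treewidth. -/
theorem exists_width_eq_treewidth {V : Type u} [Finite V] (G : SimpleGraph V) :
    ∃ D : G.TreeDecomposition, D.width = G.treewidth := by
  have := Fintype.ofFinite V
  let D : G.TreeDecomposition :=
    { I := Unit
      T := ⊥
      bag := fun _ => Finset.univ
      isTree := IsTree.of_subsingleton
      exists_mem_bag := fun v => ⟨(), Finset.mem_univ v⟩
      exists_adj_mem_bag := fun a b _ => ⟨(), Finset.mem_univ a, Finset.mem_univ b⟩
      mem_bag_of_mem_path := fun _ _ _ _ _ _ v _ _ => Finset.mem_univ v }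
  have hne : (Set.range fun D : G.TreeDecomposition => D.width).Nonempty := ⟨_, D, rfl⟩
  have hbd : BddBelow (Set.range fun D : G.TreeDecomposition => D.width) := by
    refine ⟨-1, ?_⟩
    rintro _ ⟨E, rfl⟩
    simp only [TreeDecomposition.width]
    omega
  exact Int.csInf_mem hne hbd

end SimpleGraph

/-! Take an optimal tree decomposition and let F join vertices that share a bag. F is a chordal
supergraph of G whose cliques have at most t + 1 vertices (`hasSimplicialVertices_fill`). Every
vertex set W contains an F-clique S such that W \ S splits into three groups, each at most half of
it, with no F-edges between them (`exists_balanced_separator`).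

Make S a clique, encode each group together with S recursively, and rename colours so that the
encodings agree on S, where every coordinate is now injective. Two kinds of pairs still need a
coordinate in which they agree: pairs in S that are nonadjacent in G, and pairs from different
groups. A single batch of t + 2 coordinates serves both (`hasEncodingOn_of_separator`): with m odd
and c a proper colouring of F on W by `ZMod m`, coordinate j merges nonadjacent a, b in S with c a +
c b = j, and colours a vertex v of group p v by c v + p v * j.

Up to the additive t + 1 coming from S, the size halves in each round, so log₂ n + 1 batches
suffice. -/

namespace SimpleGraph

universe u

variable {V : Type u}

/-! ### Chordal graphs: colourings and balanced clique separators -/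

/-- Every nonempty finite set `W` of vertices has a vertex whose neighbours in `W` form a clique
of at most `t` vertices. For finite graphs: chordal with clique number at most `t + 1`. -/
def HasSimplicialVertices (F : SimpleGraph V) (t : ℕ) : Prop :=
  ∀ W : Finset V, W.Nonempty → ∃ v ∈ W, ∃ K : Finset V, K.card ≤ t ∧ F.IsClique K ∧
    ∀ a ∈ W, F.Adj v a → a ∈ K

namespace HasSimplicialVertices

variable {F : SimpleGraph V} {t : ℕ}

theorem card_le_of_isClique (hF : F.HasSimplicialVertices t) {S : Finset V}
    (hS : F.IsClique S) : S.card ≤ t + 1 := by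
  classical
  rcases S.eq_empty_or_nonempty with rfl | hne
  · simp
  obtain ⟨v, hv, K, hK, -, h⟩ := hF S hne
  have hsub : S.erase v ⊆ K := fun a ha =>
    h a (Finset.mem_of_mem_erase ha)
      (hS hv (Finset.mem_of_mem_erase ha) (Finset.ne_of_mem_erase ha).symm)
  have h1 := Finset.card_le_card hsub
  rw [Finset.card_erase_of_mem hv] at h1
  omega

/-- Greedy colouring: a simplicial vertex sees at most t colours, so one is free. -/
theorem exists_coloring_on (hF : F.HasSimplicialVertices t) {α : Type*} [Finite α]
    (hα : t < Nat.card α) (W : Finset V) :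
    ∃ c : V → α, ∀ a ∈ W, ∀ b ∈ W, F.Adj a b → c a ≠ c b := by
  classical
  have := Fintype.ofFinite α
  rw [Nat.card_eq_fintype_card] at hα
  induction W using Finset.strongInduction with
  | H W ih =>
    rcases W.eq_empty_or_nonempty with rfl | hne
    · have : Nonempty α := Fintype.card_pos_iff.mp (by omega)
      exact ⟨fun _ => Classical.arbitrary α, by simp⟩
    obtain ⟨v, hv, K, hK, -, h⟩ := hF W hne
    obtain ⟨c, hc⟩ := ih (W.erase v) (Finset.erase_ssubset hv)
    obtain ⟨x, hx⟩ : ∃ x, x ∉ K.image c := by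
      by_contra! hall
      have h1 : (Finset.univ : Finset α).card ≤ (K.image c).card :=
        Finset.card_le_card fun x _ => hall x
      have h2 := Finset.card_image_le (s := K) (f := c)
      rw [Finset.card_univ] at h1
      omega
    have hxK : ∀ a ∈ W, F.Adj v a → x ≠ c a := fun a ha hva hxa =>
      hx (hxa ▸ Finset.mem_image_of_mem c (h a ha hva))
    refine ⟨Function.update c v x, fun a ha b hb hab => ?_⟩
    by_cases hav : a = v
    · subst hav
      simpa [Function.update_of_ne hab.ne'] using hxK b hb hab
    by_cases hbv : b = v
    · subst hbv
      simpa [Function.update_of_ne hav] using (hxK a ha hab.symm).symm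
    simpa [Function.update_of_ne hav, Function.update_of_ne hbv] using
      hc a (Finset.mem_erase.mpr ⟨hav, ha⟩) b (Finset.mem_erase.mpr ⟨hbv, hb⟩) hab

/-- In a chordal graph, if every vertex of a clique `S` has a neighbour in a set `C` that spans a
connected graph, then some vertex of `C` is adjacent to all of `S`. -/
theorem exists_forall_adj [DecidableEq V] (hF : F.HasSimplicialVertices t) {S : Finset V}
    (hS : F.IsClique S) (C : Finset V) (hne : C.Nonempty) (hd : Disjoint S C)
    (hconn : ∀ A B : Finset V, A.Nonempty → B.Nonempty → Disjoint A B → A ∪ B = C →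
      ∃ a ∈ A, ∃ b ∈ B, F.Adj a b)
    (hnbr : ∀ s ∈ S, ∃ c ∈ C, F.Adj s c) : ∃ c ∈ C, ∀ s ∈ S, F.Adj s c := by
  induction C using Finset.strongInduction with
  | H C ih =>
    -- If the simplicial vertex v is in S, any neighbour of it in C is adjacent to all of S. If v is
    -- in C, it can be deleted: its neighbours are pairwise adjacent, so C stays connected, and a
    -- vertex of S adjacent to v is adjacent to the other neighbours of v in C.
    obtain ⟨v, hv, K, -, hK, h⟩ := hF (S ∪ C) (hne.mono Finset.subset_union_right)
    rcases Finset.mem_union.mp hv with hvS | hvC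
    · obtain ⟨c, hc, hvc⟩ := hnbr v hvS
      refine ⟨c, hc, fun s hs => ?_⟩
      by_cases hsv : s = v
      · exact hsv ▸ hvc
      · exact hK (h s (Finset.mem_union_left _ hs) (hS hvS hs (Ne.symm hsv)))
          (h c (Finset.mem_union_right _ hc) hvc)
          (fun hsc => Finset.disjoint_left.mp hd hs (hsc ▸ hc))
    by_cases hC : C = {v}
    · refine ⟨v, hvC, fun s hs => ?_⟩
      obtain ⟨c, hc, hsc⟩ := hnbr s hs
      rw [hC, Finset.mem_singleton] at hc
      exact hc ▸ hsc
    have hne' : (C.erase v).Nonempty := by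
      rw [Finset.nonempty_iff_ne_empty]
      intro he
      rcases Finset.erase_eq_empty_iff _ _ |>.mp he with h0 | h0
      · exact hne.ne_empty h0
      · exact hC h0
    have hsub : C.erase v ⊆ C := Finset.erase_subset _ _
    have hconn' : ∀ A B : Finset V, A.Nonempty → B.Nonempty → Disjoint A B →
        A ∪ B = C.erase v → ∃ a ∈ A, ∃ b ∈ B, F.Adj a b := by
      intro A B hA hB hAB hABC
      by_contra! hno
      have hAC : ∀ a ∈ A, a ∈ C.erase v := fun a ha => hABC ▸ Finset.mem_union_left _ ha
      have hBC : ∀ b ∈ B, b ∈ C.erase v := fun b hb => hABC ▸ Finset.mem_union_right _ hb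
      have hCe : insert v (A ∪ B) = C := by rw [hABC, Finset.insert_erase hvC]
      have hvA : v ∉ A := fun hvA => by simpa using hAC v hvA
      have hvB : v ∉ B := fun hvB => by simpa using hBC v hvB
      obtain ⟨a, ha, b, hb, hab⟩ := hconn (insert v A) B (Finset.insert_nonempty _ _) hB
        (Finset.disjoint_insert_left.mpr ⟨hvB, hAB⟩) (by rw [Finset.insert_union, hCe])
      obtain ⟨a', ha', b', hb', hab'⟩ := hconn A (insert v B) hA (Finset.insert_nonempty _ _)
        (Finset.disjoint_insert_right.mpr ⟨hvA, hAB⟩) (by rw [Finset.union_insert, hCe])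
      rcases Finset.mem_insert.mp ha with rfl | ha
      · rcases Finset.mem_insert.mp hb' with rfl | hb'
        · exact hno a' ha' b hb (hK
            (h a' (Finset.mem_union_right _ (hsub (hAC a' ha'))) hab'.symm)
            (h b (Finset.mem_union_right _ (hsub (hBC b hb))) hab)
            (fun he => Finset.disjoint_left.mp hAB ha' (he ▸ hb)))
        · exact hno a' ha' b' hb' hab'
      · exact hno a ha b hb hab
    have hnbr' : ∀ s ∈ S, ∃ c ∈ C.erase v, F.Adj s c := by
      intro s hs
      obtain ⟨c, hc, hsc⟩ := hnbr s hs
      by_cases hcv : c = v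
      · subst hcv
        obtain ⟨a, ha, b, hb, hab⟩ := hconn {c} (C.erase c) (Finset.singleton_nonempty _) hne'
          (by simp) (by rw [← Finset.insert_eq, Finset.insert_erase hvC])
        rw [Finset.mem_singleton] at ha
        subst ha
        refine ⟨b, hb, hK (h s (Finset.mem_union_left _ hs) hsc.symm)
          (h b (Finset.mem_union_right _ (hsub hb)) hab) ?_⟩
        rintro rfl
        exact Finset.disjoint_left.mp hd hs (hsub hb)
      · exact ⟨c, Finset.mem_erase.mpr ⟨hcv, hc⟩, hsc⟩
    obtain ⟨c, hc, hcs⟩ := ih (C.erase v) (Finset.erase_ssubset hvC) hne'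
      (hd.mono_right hsub) hconn' hnbr'
    exact ⟨c, hsub hc, hcs⟩

/-- The induction behind `exists_balanced_separator`: `S` is a clique of `W` that separates the
majority `C` of the other vertices from the remaining ones. -/
theorem exists_balanced_separator_of_majority [DecidableEq V] (hF : F.HasSimplicialVertices t)
    (W : Finset V) (N : ℕ) : ∀ S C R : Finset V, 2 * C.card + S.card ≤ N → S ⊆ W →
      C ∪ R = W \ S → Disjoint C R → F.IsClique S → (∀ a ∈ C, ∀ b ∈ R, ¬F.Adj a b) →
      R.card < C.card →
      ∃ T : Finset V, T ⊆ W ∧ F.IsClique T ∧ ∃ p : V → Fin 3,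
        (∀ a ∈ W \ T, ∀ b ∈ W \ T, F.Adj a b → p a = p b) ∧
        ∀ i, 2 * ((W \ T).filter fun v => p v = i).card ≤ (W \ T).card := by
  have parts : ∀ T A B D : Finset V, T ⊆ W → F.IsClique T → A ∪ (B ∪ D) = W \ T →
      Disjoint A B → Disjoint A D → Disjoint B D →
      (∀ a ∈ A, ∀ b ∈ B, ¬F.Adj a b) → (∀ a ∈ A, ∀ b ∈ D, ¬F.Adj a b) →
      (∀ a ∈ B, ∀ b ∈ D, ¬F.Adj a b) →
      A.card ≤ B.card + D.card → B.card ≤ A.card + D.card → D.card ≤ A.card + B.card →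
      ∃ T : Finset V, T ⊆ W ∧ F.IsClique T ∧ ∃ p : V → Fin 3,
        (∀ a ∈ W \ T, ∀ b ∈ W \ T, F.Adj a b → p a = p b) ∧
        ∀ i, 2 * ((W \ T).filter fun v => p v = i).card ≤ (W \ T).card := by
    intro T A B D hT hTc hU hAB hAD hBD nAB nAD nBD h1 h2 h3
    have hcard : (W \ T).card = A.card + (B.card + D.card) := by
      rw [← hU, Finset.card_union_of_disjoint (Finset.disjoint_union_right.mpr ⟨hAB, hAD⟩),
        Finset.card_union_of_disjoint hBD]
    let p : V → Fin 3 := fun v => if v ∈ A then 0 else if v ∈ B then 1 else 2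
    have hpA : ∀ v ∈ A, p v = 0 := fun v hv => if_pos hv
    have hpB : ∀ v ∈ B, p v = 1 := fun v hv => by
      simp [p, hv, Finset.disjoint_right.mp hAB hv]
    have hpD : ∀ v ∈ D, p v = 2 := fun v hv => by
      simp [p, Finset.disjoint_right.mp hBD hv, Finset.disjoint_right.mp hAD hv]
    refine ⟨T, hT, hTc, p, ?_, ?_⟩
    · rw [← hU]
      intro a ha b hb hab
      simp only [Finset.mem_union] at ha hb
      rcases ha with ha | ha | ha <;> rcases hb with hb | hb | hb <;>
        simp only [hpA, hpB, hpD, ha, hb]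
      · exact absurd hab (nAB a ha b hb)
      · exact absurd hab (nAD a ha b hb)
      · exact absurd hab.symm (nAB b hb a ha)
      · exact absurd hab (nBD a ha b hb)
      · exact absurd hab.symm (nAD b hb a ha)
      · exact absurd hab.symm (nBD b hb a ha)
    · have hsub : ∀ i, ∀ X : Finset V, (∀ v ∈ A ∪ (B ∪ D), p v = i → v ∈ X) →
          ((W \ T).filter fun v => p v = i).card ≤ X.card := fun i X hX =>
        Finset.card_le_card fun v hv => by
          rw [← hU, Finset.mem_filter] at hv
          exact hX v hv.1 hv.2
      have q0 := hsub 0 A fun v hv hp => by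
        simp only [Finset.mem_union] at hv
        rcases hv with hv | hv | hv
        · exact hv
        · simp [hpB v hv] at hp
        · simp [hpD v hv] at hp
      have q1 := hsub 1 B fun v hv hp => by
        simp only [Finset.mem_union] at hv
        rcases hv with hv | hv | hv
        · simp [hpA v hv] at hp
        · exact hv
        · simp [hpD v hv] at hp
      have q2 := hsub 2 D fun v hv hp => by
        simp only [Finset.mem_union] at hv
        rcases hv with hv | hv | hv
        · simp [hpA v hv] at hp
        · simp [hpB v hv] at hp
        · exact hv
      intro i
      fin_cases i <;> simp only [Fin.zero_eta, Fin.mk_one, Fin.reduceFinMk] <;> omega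
  -- 2|C| + |S| drops when C is replaced by one of its pieces, when a vertex moves from C to S, and
  -- when one moves from S to R. Each of the last two moves lowers |C| - |R| by one, so this
  -- difference hits 0 before turning negative; at 0 the groups C, R, ∅ are balanced.
  induction N with
  | zero =>
    intro S C R hN _ _ _ _ _ hlt
    omega
  | succ N ih =>
    intro S C R hN hSW hU hCR hS hno hlt
    have hmem : ∀ v, v ∈ C ∨ v ∈ R ↔ v ∈ W ∧ v ∉ S := fun v => by
      rw [← Finset.mem_union, hU, Finset.mem_sdiff]
    have hCne : C.Nonempty := Finset.card_pos.mp (by omega)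
    have hSC : Disjoint S C := Finset.disjoint_left.mpr fun v hv hvC =>
      ((hmem v).mp (Or.inl hvC)).2 hv
    have hSR : Disjoint S R := Finset.disjoint_left.mpr fun v hv hvR =>
      ((hmem v).mp (Or.inr hvR)).2 hv
    by_cases hconn : ∀ A B : Finset V, A.Nonempty → B.Nonempty → Disjoint A B → A ∪ B = C →
      ∃ a ∈ A, ∃ b ∈ B, F.Adj a b
    swap
    · push Not at hconn
      obtain ⟨A, B, hA, hB, hAB, rfl, hn⟩ := hconn
      have hc := Finset.card_union_of_disjoint hAB
      have hAp := hA.card_pos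
      have hBp := hB.card_pos
      obtain ⟨hAR, hBR⟩ := Finset.disjoint_union_left.mp hCR
      have nAR : ∀ a ∈ A, ∀ b ∈ R, ¬F.Adj a b := fun a ha =>
        hno a (Finset.mem_union_left _ ha)
      have nBR : ∀ a ∈ B, ∀ b ∈ R, ¬F.Adj a b := fun a ha =>
        hno a (Finset.mem_union_right _ ha)
      -- R is smaller than A ∪ B, so only A or B can outweigh the other two groups; if one does, it
      -- is the new majority.
      by_cases h1 : A.card ≤ B.card + R.card
      · by_cases h2 : B.card ≤ A.card + R.card
        · exact parts S A B R hSW hS (by rw [← hU, Finset.union_assoc]) hAB hAR hBR hn nAR nBR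
            h1 h2 (by omega)
        · refine ih S B (A ∪ R) (by omega) hSW
            (by rw [← hU, ← Finset.union_assoc, Finset.union_comm B A])
            (Finset.disjoint_union_right.mpr ⟨hAB.symm, hBR⟩) hS ?_ ?_
          · intro b hb a ha
            rcases Finset.mem_union.mp ha with ha | ha
            · exact fun h => hn a ha b hb h.symm
            · exact nBR b hb a ha
          · rw [Finset.card_union_of_disjoint hAR]
            omega
      · refine ih S A (B ∪ R) (by omega) hSW (by rw [← hU, Finset.union_assoc])
          (Finset.disjoint_union_right.mpr ⟨hAB, hAR⟩) hS ?_ ?_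
        · intro a ha b hb
          rcases Finset.mem_union.mp hb with hb | hb
          · exact hn a ha b hb
          · exact nAR a ha b hb
        · rw [Finset.card_union_of_disjoint hBR]
          omega
    by_cases hnbr : ∀ s ∈ S, ∃ c ∈ C, F.Adj s c
    · obtain ⟨c, hc, hcS⟩ := hF.exists_forall_adj hS C hCne hSC hconn hnbr
      have hcW := (hmem c).mp (Or.inl hc)
      have hT : insert c S ⊆ W := Finset.insert_subset hcW.1 hSW
      have hTc : F.IsClique (insert c S : Finset V) := by
        rw [Finset.coe_insert]
        exact hS.insert fun b hb _ => (hcS b hb).symm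
      have hU' : C.erase c ∪ R = W \ insert c S := by
        ext v
        have := hmem v
        have hcR := Finset.disjoint_left.mp hCR hc
        simp only [Finset.mem_union, Finset.mem_erase, Finset.mem_sdiff, Finset.mem_insert]
        by_cases hvc : v = c
        · subst hvc
          simp [hcR]
        · tauto
      have hCR' : Disjoint (C.erase c) R := hCR.mono_left (Finset.erase_subset _ _)
      have hno' : ∀ a ∈ C.erase c, ∀ b ∈ R, ¬F.Adj a b := fun a ha =>
        hno a (Finset.mem_of_mem_erase ha)
      have hcc := Finset.card_erase_of_mem hc
      have hci := Finset.card_insert_of_notMem hcW.2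
      by_cases heq : (C.erase c).card = R.card
      · exact parts (insert c S) (C.erase c) R ∅ hT hTc (by simpa using hU') hCR' (by simp)
          (by simp) hno' (by simp) (by simp) (by simp [heq]) (by simp [heq]) (by simp)
      · exact ih (insert c S) (C.erase c) R (by omega) hT hU' hCR' hTc hno' (by omega)
    · push Not at hnbr
      obtain ⟨s, hs, hsC⟩ := hnbr
      have hsR : s ∉ R := Finset.disjoint_left.mp hSR hs
      have hsC' : s ∉ C := Finset.disjoint_left.mp hSC hs
      have hT : S.erase s ⊆ W := (Finset.erase_subset _ _).trans hSW
      have hTc : F.IsClique (S.erase s : Finset V) := hS.subset (by simp)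
      have hU' : C ∪ insert s R = W \ S.erase s := by
        ext v
        have := hmem v
        simp only [Finset.mem_union, Finset.mem_erase, Finset.mem_sdiff, Finset.mem_insert]
        by_cases hvs : v = s
        · subst hvs
          simp [hSW hs]
        · tauto
      have hCR' : Disjoint C (insert s R) := Finset.disjoint_insert_right.mpr ⟨hsC', hCR⟩
      have hno' : ∀ a ∈ C, ∀ b ∈ insert s R, ¬F.Adj a b := fun a ha b hb => by
        rcases Finset.mem_insert.mp hb with rfl | hb
        · exact fun h => hsC a ha h.symm
        · exact hno a ha b hb
      have hcc := Finset.card_erase_of_mem hs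
      have hsp := Finset.card_pos.mpr ⟨s, hs⟩
      have hci := Finset.card_insert_of_notMem hsR
      by_cases heq : C.card = (insert s R).card
      · exact parts (S.erase s) C (insert s R) ∅ hT hTc (by simpa using hU') hCR' (by simp)
          (by simp) hno' (by simp) (by simp) (by simp [heq]) (by simp [heq]) (by simp)
      · exact ih (S.erase s) C (insert s R) (by omega) hT hU' hCR' hTc hno' (by omega)

/-- Every set `W` of vertices of a chordal graph has a clique `S` such that the other vertices of
`W` form three groups without edges between them, none larger than the other two together. -/
theorem exists_balanced_separator [DecidableEq V] (hF : F.HasSimplicialVertices t)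
    (W : Finset V) :
    ∃ S : Finset V, S ⊆ W ∧ F.IsClique S ∧ ∃ p : V → Fin 3,
      (∀ a ∈ W \ S, ∀ b ∈ W \ S, F.Adj a b → p a = p b) ∧
      ∀ i, 2 * ((W \ S).filter fun v => p v = i).card ≤ (W \ S).card := by
  rcases W.eq_empty_or_nonempty with rfl | hne
  · exact ⟨∅, by simp, by simp, fun _ => 0, by simp, by simp⟩
  · exact hF.exists_balanced_separator_of_majority W _ ∅ W ∅ le_rfl (by simp) (by simp)
      (by simp) (by simp) (by simp) (by simpa using hne)

end HasSimplicialVertices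

/-! ### Tree decompositions: sharing a bag is a chordal relation -/

theorem Walk.dist_lt_of_mem_support {T : SimpleGraph V} {x r z : V} {s : T.Walk x r}
    (hs : s.length = T.dist x r) (hz : z ∈ s.support) (hne : z ≠ x) :
    T.dist z r < T.dist x r := by
  classical
  have h1 := congrArg Walk.length (s.take_spec hz)
  rw [Walk.length_append] at h1
  have h2 := dist_le (s.dropUntil z hz)
  have h3 : (s.takeUntil z hz).length ≠ 0 := fun h => hne (Walk.eq_of_length_eq_zero h).symm
  omega

namespace TreeDecomposition

variable {G : SimpleGraph V} (D : G.TreeDecomposition)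

/-- The graph in which distinct vertices are adjacent when they share a bag. -/
def fill : SimpleGraph V where
  Adj a b := a ≠ b ∧ ∃ i, a ∈ D.bag i ∧ b ∈ D.bag i
  symm := ⟨fun _ _ ⟨h, i, ha, hb⟩ => ⟨h.symm, i, hb, ha⟩⟩
  loopless := ⟨fun _ h => h.1 rfl⟩

theorem le_fill : G ≤ D.fill := fun a b h => ⟨h.ne, D.exists_adj_mem_bag a b h⟩

variable {D}

/-- The path from x to y stays in bags containing v, and a shortest path from y to r gets strictly
closer to r after y. By minimality they meet only in y, so their concatenation is the unique path
from x to r. -/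
theorem mem_support_of_forall_dist_le {r x y : D.I} {v : V} (hx : v ∈ D.bag x)
    (hy : v ∈ D.bag y) (hmin : ∀ j, v ∈ D.bag j → D.T.dist y r ≤ D.T.dist j r)
    {p : D.T.Walk x r} (hp : p.IsPath) : y ∈ p.support := by
  obtain ⟨q, hq, -⟩ := D.isTree.connected.exists_path_of_dist x y
  obtain ⟨s, hs, hsd⟩ := D.isTree.connected.exists_path_of_dist y r
  have hqs : (q.append s).IsPath := by
    rw [Walk.isPath_def, Walk.support_append, List.nodup_append']
    refine ⟨hq.support_nodup, hs.support_nodup.tail, fun z hzq hzs => ?_⟩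
    have hzy : z ≠ y := by
      rintro rfl
      have := hs.support_nodup
      rw [← Walk.cons_tail_support] at this
      exact (List.nodup_cons.mp this).1 hzs
    have h1 := Walk.dist_lt_of_mem_support hsd (List.mem_of_mem_tail hzs) hzy
    have h2 := hmin z (D.mem_bag_of_mem_path x z y q hq hzq v hx hy)
    omega
  rw [(D.isTree.existsUnique_path x r).unique hp hqs, Walk.mem_support_append_iff]
  exact Or.inl q.end_mem_support

/-- Both y and z lie on the path from x to r, and z is no farther from r than y, so y lies between x
and z. -/
theorem mem_bag_of_dist_le {r x y z : D.I} {a v : V} (hax : a ∈ D.bag x) (hvx : v ∈ D.bag x)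
    (hv : v ∈ D.bag y) (hvmin : ∀ j, v ∈ D.bag j → D.T.dist y r ≤ D.T.dist j r)
    (ha : a ∈ D.bag z) (hamin : ∀ j, a ∈ D.bag j → D.T.dist z r ≤ D.T.dist j r)
    (hle : D.T.dist z r ≤ D.T.dist y r) : a ∈ D.bag y := by
  classical
  obtain ⟨p, hp, hpd⟩ := D.isTree.connected.exists_path_of_dist x r
  have hyp := mem_support_of_forall_dist_le hvx hv hvmin hp
  have hzp := mem_support_of_forall_dist_le hax ha hamin hp
  rw [← p.take_spec hzp, Walk.mem_support_append_iff] at hyp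
  rcases hyp with hyp | hyp
  · exact D.mem_bag_of_mem_path x y z _ (hp.takeUntil hzp) hyp a hax ha
  · by_cases hyz : y = z
    · exact hyz ▸ ha
    have := Walk.dist_lt_of_mem_support
      (length_eq_dist_of_subwalk hpd (p.isSubwalk_dropUntil hzp)) hyp hyz
    omega

variable (D)

/-- Root the tree at r. The vertex of W whose topmost bag is farthest from r is simplicial: all its
neighbours in W lie in that bag. -/
theorem hasSimplicialVertices_fill {t : ℕ} (ht : ∀ i, (D.bag i).card ≤ t + 1) :
    D.fill.HasSimplicialVertices t := by
  classical
  obtain ⟨r⟩ := D.isTree.connected.nonempty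
  have htop : ∀ v, ∃ y, v ∈ D.bag y ∧ ∀ j, v ∈ D.bag j → D.T.dist y r ≤ D.T.dist j r := by
    intro v
    obtain ⟨i, hi⟩ := D.exists_mem_bag v
    obtain ⟨y, hy, hmin⟩ := Finset.exists_min_image (Finset.univ.filter fun i => v ∈ D.bag i)
      (fun i => D.T.dist i r) ⟨i, by simpa using hi⟩
    exact ⟨y, by simpa using hy, fun j hj => hmin j (by simpa using hj)⟩
  choose top hmem hmin using htop
  intro W hW
  obtain ⟨v, hv, hmax⟩ := Finset.exists_max_image W (fun v => D.T.dist (top v) r) hW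
  refine ⟨v, hv, (D.bag (top v)).erase v, ?_, ?_, ?_⟩
  · rw [Finset.card_erase_of_mem (hmem v)]
    have := ht (top v)
    omega
  · intro a ha b hb hab
    exact ⟨hab, top v, Finset.mem_of_mem_erase ha, Finset.mem_of_mem_erase hb⟩
  · rintro a ha ⟨hva, x, hvx, hax⟩
    exact Finset.mem_erase.mpr ⟨hva.symm,
      mem_bag_of_dist_le hax hvx (hmem v) (hmin v) (hmem a) (hmin a) (hmax a ha)⟩

end TreeDecomposition

/-! ### Encodings on vertex sets and their gluing -/

/-- The colourings `φ j` form an encoding of the subgraph of `G` induced by `W`. -/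
structure IsEncodingOn (G : SimpleGraph V) (W : Finset V) {ι α : Type*} (φ : ι → V → α) :
    Prop where
  ne_of_adj : ∀ a ∈ W, ∀ b ∈ W, G.Adj a b → ∀ j, φ j a ≠ φ j b
  exists_eq : ∀ a ∈ W, ∀ b ∈ W, a ≠ b → ¬G.Adj a b → ∃ j, φ j a = φ j b
  exists_ne : ∀ a ∈ W, ∀ b ∈ W, a ≠ b → ∃ j, φ j a ≠ φ j b

/-- The subgraph of `G` induced by `W` has an encoding with `l` coordinates. -/
def HasEncodingOn (G : SimpleGraph V) (W : Finset V) (l : ℕ) : Prop :=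
  ∃ φ : Fin l → V → ℕ, G.IsEncodingOn W φ

theorem IsEncodingOn.hasEncodingOn {G : SimpleGraph V} {W : Finset V} {ι α : Type*} [Fintype ι]
    [Countable α] {φ : ι → V → α} (h : G.IsEncodingOn W φ) :
    G.HasEncodingOn W (Fintype.card ι) := by
  obtain ⟨f, hf⟩ := exists_injective_nat α
  let e := Fintype.equivFin ι
  refine ⟨fun j v => f (φ (e.symm j) v), ?_, ?_, ?_⟩
  · exact fun a ha b hb hab j => hf.ne (h.ne_of_adj a ha b hb hab _)
  · intro a ha b hb hne hab
    obtain ⟨j, hj⟩ := h.exists_eq a ha b hb hne hab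
    exact ⟨e j, by simp [hj]⟩
  · intro a ha b hb hne
    obtain ⟨j, hj⟩ := h.exists_ne a ha b hb hne
    exact ⟨e j, by simpa [hf.eq_iff] using hj⟩

theorem HasEncodingOn.pdim_le [Fintype V] {G : SimpleGraph V} {l : ℕ}
    (hl : 0 < l) (h : G.HasEncodingOn Finset.univ l) : G.pdim ≤ l := by
  obtain ⟨φ, h⟩ := h
  refine Nat.sInf_le ⟨fun v j => φ j v, ?_, fun a b => ⟨fun hab j => ?_, fun hall => ?_⟩⟩
  · intro a b hab
    by_contra hne
    obtain ⟨j, hj⟩ := h.exists_ne a (Finset.mem_univ a) b (Finset.mem_univ b) hne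
    exact hj (congrFun hab j)
  · exact h.ne_of_adj a (Finset.mem_univ a) b (Finset.mem_univ b) hab j
  · by_contra hab
    by_cases hne : a = b
    -- With no coordinates, a vertex would vacuously differ from itself everywhere; hence l must be
    -- positive.
    · exact hall ⟨0, hl⟩ (hne ▸ rfl)
    · obtain ⟨j, hj⟩ := h.exists_eq a (Finset.mem_univ a) b (Finset.mem_univ b) hne hab
      exact hall j hj

/-- Colourings indexed by `ZMod m` in which nonadjacent vertices `a`, `b` of `S` agree exactly in
the coordinate `c a + c b`. -/
theorem exists_matching_coloring (G : SimpleGraph V) {S : Finset V} {m : ℕ} {c : V → ZMod m}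
    (hc : Set.InjOn c S) : ∃ ψ : ZMod m → V → Finset V, ∀ j, ∀ a ∈ S, ∀ b ∈ S, a ≠ b →
      (ψ j a = ψ j b ↔ c a + c b = j ∧ ¬G.Adj a b) := by
  classical
  -- The colour of v in S is the set of v and its partner, if any: since c is injective on S, at
  -- most one x in S has c v + c x = j. Partners get the same set.
  refine ⟨fun j v => S.filter fun x => x = v ∨ (c v + c x = j ∧ ¬G.Adj v x),
    fun j a ha b hb hne => ⟨fun h => ?_, fun ⟨hj, hab⟩ => ?_⟩⟩
  · have hbmem : b ∈ S.filter fun x => x = a ∨ (c a + c x = j ∧ ¬G.Adj a x) := by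
      refine (congrArg (b ∈ ·) h).mpr ?_
      simp [hb]
    exact (Finset.mem_filter.mp hbmem).2.resolve_left hne.symm
  · have hcls : ∀ u ∈ S, ∀ w ∈ S, c u + c w = j → ∀ x ∈ S, c u + c x = j → x = w :=
      fun u _ w hw h1 x hx h2 => hc hx hw (add_left_cancel (h2.trans h1.symm))
    ext x
    simp only [Finset.mem_filter, and_congr_right_iff]
    intro hx
    constructor
    · rintro (rfl | ⟨h1, -⟩)
      · exact Or.inr ⟨by rw [add_comm, hj], fun h => hab h.symm⟩
      · exact Or.inl (hcls a ha b hb hj x hx h1)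
    · rintro (rfl | ⟨h1, -⟩)
      · exact Or.inr ⟨hj, hab⟩
      · exact Or.inl (hcls b hb a ha (by rw [add_comm, hj]) x hx h1)

/-- There are enough residues for c to be injective on all of W, so the matching colourings alone
form an encoding; m ≥ 2 provides a coordinate other than c a + c b, where a and b differ. -/
theorem hasEncodingOn_of_card_le [Countable V] (G : SimpleGraph V) {W : Finset V} {m : ℕ}
    (hm : 2 ≤ m) (hW : W.card ≤ m) : G.HasEncodingOn W m := by
  classical
  have : NeZero m := ⟨by omega⟩
  have : Fact (1 < m) := ⟨hm⟩
  obtain ⟨e⟩ : Nonempty (W ↪ ZMod m) :=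
    Function.Embedding.nonempty_of_card_le (by simpa [ZMod.card] using hW)
  let c : V → ZMod m := fun v => if h : v ∈ W then e ⟨v, h⟩ else 0
  have hc : Set.InjOn c W := by
    intro a ha b hb hab
    simpa [c, Finset.mem_coe.mp ha, Finset.mem_coe.mp hb] using hab
  obtain ⟨ψ, hψ⟩ := exists_matching_coloring G hc
  have h : G.IsEncodingOn W ψ := by
    refine ⟨fun a ha b hb hab j hj => ((hψ j a ha b hb hab.ne).mp hj).2 hab,
      fun a ha b hb hne hab => ⟨_, (hψ _ a ha b hb hne).mpr ⟨rfl, hab⟩⟩,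
      fun a ha b hb hne => ?_⟩
    obtain ⟨j, hj⟩ := exists_ne (c a + c b)
    exact ⟨j, fun h => hj ((hψ j a ha b hb hne).mp h).1.symm⟩
  simpa [ZMod.card] using h.hasEncodingOn

/-- Encodings of `G`, with the set `S` made a clique, on the sets `S ∪ p⁻¹(i)` can be renamed so
that they agree on `S`. -/
theorem exists_glued_coloring {S : Finset V} {ι κ : Type*} (p : V → κ) (φ : κ → ι → V → ℕ)
    (hφ : ∀ i j, Set.InjOn (φ i j) S) : ∃ Φ : ι → V → V ⊕ κ × ℕ,
      ∀ i j a b, (a ∈ S ∨ p a = i) → (b ∈ S ∨ p b = i) → (Φ j a = Φ j b ↔ φ i j a = φ i j b) := by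
  classical
  -- A colour occurring on S is renamed to the vertex of S that has it, unique by injectivity; all
  -- other colours are tagged with i.
  let ρ : κ → ι → V → V ⊕ κ × ℕ := fun i j v =>
    if h : ∃ s ∈ S, φ i j s = φ i j v then Sum.inl h.choose else Sum.inr (i, φ i j v)
  have hρS : ∀ i j, ∀ s ∈ S, ρ i j s = Sum.inl s := by
    intro i j s hs
    have h : ∃ s' ∈ S, φ i j s' = φ i j s := ⟨s, hs, rfl⟩
    simp only [ρ, dif_pos h]
    exact congrArg _ (hφ i j h.choose_spec.1 hs h.choose_spec.2)
  have hρ : ∀ i j a b, ρ i j a = ρ i j b ↔ φ i j a = φ i j b := by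
    intro i j a b
    refine ⟨fun h => ?_, fun h => by simp only [ρ, h]⟩
    by_cases h1 : ∃ s ∈ S, φ i j s = φ i j a <;> by_cases h2 : ∃ s ∈ S, φ i j s = φ i j b <;>
      simp only [ρ, dif_pos, dif_neg, h1, h2, not_false_eq_true, Sum.inl.injEq, Sum.inr.injEq,
        Prod.mk.injEq, true_and, reduceCtorEq] at h
    · rw [← h1.choose_spec.2, h, h2.choose_spec.2]
    · exact h
  refine ⟨fun j v => ρ (p v) j v, fun i j a b ha hb => ?_⟩
  have hΦ : ∀ v, (v ∈ S ∨ p v = i) → ρ (p v) j v = ρ i j v := by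
    rintro v (hv | rfl)
    · rw [hρS _ _ v hv, hρS _ _ v hv]
    · rfl
  simp only [hΦ a ha, hΦ b hb, hρ]

/-- The differences are ±1 and ±2, and 2 is invertible modulo an odd number. -/
theorem isUnit_fin_three_sub {m : ℕ} (hm : Odd m) {x y : Fin 3} (h : x ≠ y) :
    IsUnit ((x.val : ZMod m) - (y.val : ZMod m)) := by
  have h2 : IsUnit (2 : ZMod m) := by
    have := (ZMod.isUnit_iff_coprime 2 m).mpr (Nat.coprime_two_left.mpr hm)
    exact_mod_cast this
  have hxy : ∀ x y : Fin 3, x ≠ y → (x.val : ℤ) - y.val = 1 ∨ (x.val : ℤ) - y.val = -1 ∨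
      (x.val : ℤ) - y.val = 2 ∨ (x.val : ℤ) - y.val = -2 := by decide
  have hcast : (x.val : ZMod m) - (y.val : ZMod m) = (((x.val : ℤ) - y.val : ℤ) : ZMod m) := by
    push_cast
    rfl
  rw [hcast]
  rcases hxy x y h with h | h | h | h <;> rw [h] <;> simp [h2]

/-- The glued coordinates settle the pairs within one S ∪ p⁻¹(i), except those in S whose adjacency
was added. The m coordinates `χ` merge these and the pairs from different groups. The other k
coordinates are injective; if k = 0, then m ≥ 2 and a second coordinate of `χ` tells vertices of
different groups apart. -/
theorem hasEncodingOn_of_separator [DecidableEq V] [Countable V] {G : SimpleGraph V}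
    {W S : Finset V} {p : V → Fin 3}
    (hp : ∀ a ∈ W \ S, ∀ b ∈ W \ S, G.Adj a b → p a = p b) {m k l : ℕ} (hm : Odd m)
    (hmk : 2 ≤ m + k) {c : V → ZMod m} (hc : ∀ a ∈ W, ∀ b ∈ W, G.Adj a b → c a ≠ c b)
    (hcS : Set.InjOn c S)
    (h : ∀ i, (G ⊔ fromRel fun a b => a ∈ S ∧ b ∈ S).HasEncodingOn
      (S ∪ (W \ S).filter fun v => p v = i) l) : G.HasEncodingOn W (l + (m + k)) := by
  have hm0 : NeZero m := ⟨hm.pos.ne'⟩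
  set G' : SimpleGraph V := G ⊔ fromRel fun a b => a ∈ S ∧ b ∈ S with hG'
  have hGG' : ∀ a b, G.Adj a b → G'.Adj a b := fun a b h => Or.inl h
  have hSG' : ∀ a ∈ S, ∀ b ∈ S, a ≠ b → G'.Adj a b := fun a ha b hb hne =>
    Or.inr ((fromRel_adj _ _ _).mpr ⟨hne, Or.inl ⟨ha, hb⟩⟩)
  have hG'G : ∀ a b, ¬(a ∈ S ∧ b ∈ S) → ¬G.Adj a b → ¬G'.Adj a b := by
    rintro a b hS hab (h | h)
    · exact hab h
    · rw [fromRel_adj] at h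
      tauto
  choose φ hφ using h
  have hmem : ∀ i, ∀ a ∈ W, (a ∈ S ∨ p a = i) → a ∈ S ∪ (W \ S).filter fun v => p v = i := by
    intro i a ha h
    simp only [Finset.mem_union, Finset.mem_filter, Finset.mem_sdiff]
    tauto
  obtain ⟨Φ, hΦ⟩ := exists_glued_coloring (S := S) p φ fun i j a ha b hb hab => by
    by_contra hne
    exact (hφ i).ne_of_adj a (Finset.mem_union_left _ ha) b (Finset.mem_union_left _ hb)
      (hSG' a ha b hb hne) j hab
  obtain ⟨ψ, hψ⟩ := exists_matching_coloring G hcS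
  -- pairs of vertices in a common `S ∪ p⁻¹(i)`, and the other ones
  have hpair : ∀ a b, (∃ i, (a ∈ S ∨ p a = i) ∧ (b ∈ S ∨ p b = i)) ∨
      (a ∉ S ∧ b ∉ S ∧ p a ≠ p b) := by
    intro a b
    by_cases ha : a ∈ S
    · exact Or.inl ⟨p b, Or.inl ha, Or.inr rfl⟩
    by_cases hb : b ∈ S
    · exact Or.inl ⟨p a, Or.inr rfl, Or.inl hb⟩
    by_cases hab : p a = p b
    · exact Or.inl ⟨p b, Or.inr hab, Or.inr rfl⟩
    · exact Or.inr ⟨ha, hb, hab⟩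
  -- Outside S the colour is a line in j with slope p v. Adjacent vertices have equal slopes and
  -- distinct offsets, so they never agree; between different groups the slopes differ by a unit, so
  -- the lines meet for exactly one j. The sum type keeps S apart from the rest.
  let χ : ZMod m → V → Finset V ⊕ ZMod m := fun j v =>
    if v ∈ S then Sum.inl (ψ j v) else Sum.inr (c v + (p v).val * j)
  let Ψ : Fin l ⊕ (ZMod m ⊕ Fin k) → V → (V ⊕ Fin 3 × ℕ) ⊕ ((Finset V ⊕ ZMod m) ⊕ V) :=
    fun j v => match j with
      | Sum.inl j => Sum.inl (Φ j v)
      | Sum.inr (Sum.inl j) => Sum.inr (Sum.inl (χ j v))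
      | Sum.inr (Sum.inr _) => Sum.inr (Sum.inr v)
  have hcross : ∀ a b, a ∉ S → b ∉ S → p a ≠ p b → ∃ u : ZMod m, IsUnit u ∧
      ∃ j₀, ∀ j, χ j a = χ j b ↔ u * j = u * j₀ := by
    intro a b ha hb hab
    have hu := isUnit_fin_three_sub hm hab
    refine ⟨_, hu, hu.unit⁻¹ * (c b - c a), fun j => ?_⟩
    rw [← mul_assoc, IsUnit.mul_val_inv, one_mul]
    simp only [χ, ha, hb, if_false, Sum.inr.injEq]
    constructor <;> intro h <;> linear_combination h
  have hΨ : G.IsEncodingOn W Ψ := by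
    refine ⟨fun a ha b hb hab => ?_, fun a ha b hb hne hab => ?_, fun a ha b hb hne => ?_⟩
    · rintro (j | j | j) hj
      · rcases hpair a b with ⟨i, hai, hbi⟩ | ⟨haS, hbS, hpab⟩
        · exact (hφ i).ne_of_adj a (hmem i a ha hai) b (hmem i b hb hbi) (hGG' a b hab) j
            ((hΦ i j a b hai hbi).mp (Sum.inl_injective hj))
        · exact hpab (hp a (Finset.mem_sdiff.mpr ⟨ha, haS⟩) b (Finset.mem_sdiff.mpr ⟨hb, hbS⟩) hab)
      · have hj : χ j a = χ j b := Sum.inl_injective (Sum.inr_injective hj)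
        by_cases haS : a ∈ S <;> by_cases hbS : b ∈ S <;>
          simp only [χ, haS, hbS, if_true, if_false, Sum.inl.injEq, Sum.inr.injEq,
            reduceCtorEq] at hj
        · exact ((hψ j a haS b hbS hab.ne).mp hj).2 hab
        · rw [hp a (Finset.mem_sdiff.mpr ⟨ha, haS⟩) b (Finset.mem_sdiff.mpr ⟨hb, hbS⟩) hab] at hj
          exact hc a ha b hb hab (add_right_cancel hj)
      · exact hab.ne (Sum.inr_injective (Sum.inr_injective hj))
    · rcases hpair a b with ⟨i, hai, hbi⟩ | ⟨haS, hbS, hpab⟩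
      · by_cases hS : a ∈ S ∧ b ∈ S
        · refine ⟨Sum.inr (Sum.inl (c a + c b)), congrArg (Sum.inr ∘ Sum.inl) ?_⟩
          simp only [χ, hS.1, hS.2, if_true, Sum.inl.injEq]
          exact (hψ _ a hS.1 b hS.2 hne).mpr ⟨rfl, hab⟩
        · obtain ⟨j, hj⟩ := (hφ i).exists_eq a (hmem i a ha hai) b (hmem i b hb hbi) hne
            (hG'G a b hS hab)
          exact ⟨Sum.inl j, congrArg Sum.inl ((hΦ i j a b hai hbi).mpr hj)⟩
      · obtain ⟨u, -, j₀, hj⟩ := hcross a b haS hbS hpab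
        exact ⟨Sum.inr (Sum.inl j₀), congrArg (Sum.inr ∘ Sum.inl) ((hj j₀).mpr rfl)⟩
    · rcases hpair a b with ⟨i, hai, hbi⟩ | ⟨haS, hbS, hpab⟩
      · obtain ⟨j, hj⟩ := (hφ i).exists_ne a (hmem i a ha hai) b (hmem i b hb hbi) hne
        exact ⟨Sum.inl j, fun h => hj ((hΦ i j a b hai hbi).mp (Sum.inl_injective h))⟩
      · rcases Nat.eq_zero_or_pos k with rfl | hk
        · have : Fact (1 < m) := ⟨by omega⟩
          obtain ⟨u, hu, j₀, hj⟩ := hcross a b haS hbS hpab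
          refine ⟨Sum.inr (Sum.inl (j₀ + 1)), fun h => ?_⟩
          have h1 := (hj (j₀ + 1)).mp (Sum.inl_injective (Sum.inr_injective h))
          simpa using hu.mul_left_cancel h1
        · exact ⟨Sum.inr (Sum.inr ⟨0, hk⟩), fun h =>
            hne (Sum.inr_injective (Sum.inr_injective h))⟩
  simpa [ZMod.card] using hΨ.hasEncodingOn

/-! ### The recursion and the final bound -/

/-- The size bound survives a round: S with one group has at most (|W| + |S|)/2 vertices, and |S| ≤
t + 1. G varies in the induction because each round adds the edges of a clique of F. -/
theorem HasSimplicialVertices.hasEncodingOn [Countable V] {F : SimpleGraph V} {t : ℕ}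
    (hF : F.HasSimplicialVertices t) (k : ℕ) : ∀ (G : SimpleGraph V) (W : Finset V), G ≤ F →
      W.card < t + 1 + 2 ^ (k + 1) → G.HasEncodingOn W ((t + 2) * (k + 1)) := by
  classical
  -- m is odd to make 2 a unit and exceeds t so that F can be properly coloured; r pads the batch to
  -- t + 2 coordinates.
  obtain ⟨m, r, hm, hmt, hr⟩ : ∃ m r, Odd m ∧ t < m ∧ m + r = t + 2 := by
    rcases Nat.even_or_odd t with h | h
    · exact ⟨t + 1, 1, h.add_one, by omega, rfl⟩
    · exact ⟨t + 2, 0, h.add_even even_two, by omega, rfl⟩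
  have : NeZero m := ⟨hm.pos.ne'⟩
  induction k with
  | zero =>
    intro G W _ hW
    rw [zero_add, mul_one]
    exact G.hasEncodingOn_of_card_le (by omega) (by omega)
  | succ k ih =>
    intro G W hGF hW
    obtain ⟨S, hSW, hS, p, hp, hcard⟩ := hF.exists_balanced_separator W
    obtain ⟨c, hc⟩ := hF.exists_coloring_on (α := ZMod m) (by simpa using hmt) W
    have key := hasEncodingOn_of_separator (G := G) (W := W) (S := S) (p := p) (m := m) (k := r)
      (c := c) (l := (t + 2) * (k + 1)) (fun a ha b hb hab => hp a ha b hb (hGF hab)) hm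
      (by omega) (fun a ha b hb hab => hc a ha b hb (hGF hab))
      (fun a ha b hb hab => by
        by_contra hne
        exact hc a (hSW ha) b (hSW hb) (hS ha hb hne) hab)
      (fun i => ih _ _ (sup_le hGF ?_) ?_)
    · rw [hr] at key
      exact key
    · intro a b hab
      rw [fromRel_adj] at hab
      rcases hab with ⟨hne, h | h⟩
      · exact hS h.1 h.2 hne
      · exact hS h.2 h.1 hne
    · have h1 := Finset.card_union_le S ((W \ S).filter fun v => p v = i)
      have h2 := hcard i
      have h3 := Finset.card_sdiff_add_card_eq_card hSW
      have h4 := hF.card_le_of_isClique hS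
      have h5 : 2 ^ (k + 1 + 1) = 2 * 2 ^ (k + 1) := by ring
      omega

end SimpleGraph

theorem theorem2 {V : Type*} [Fintype V] [Nonempty V] (G : SimpleGraph V) (n t : ℕ)
    (hn : Fintype.card V = n) (ht : G.treewidth = (t : ℤ)) :
    (G.pdim : ℝ) ≤ ((t : ℝ) + 2) * (Real.logb 2 (n : ℝ) + 1) := by
  obtain ⟨D, hD⟩ := G.exists_width_eq_treewidth
  have hbag : ∀ i, (D.bag i).card ≤ t + 1 := by
    intro i
    have h1 : (D.bag i).card ≤ Finset.univ.sup fun i : D.I => (D.bag i).card :=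
      Finset.le_sup (f := fun i : D.I => (D.bag i).card) (Finset.mem_univ i)
    rw [ht, SimpleGraph.TreeDecomposition.width] at hD
    omega
  have hlt : n < 2 ^ (Nat.log 2 n + 1) := Nat.lt_pow_succ_log_self (by norm_num) n
  have henc := (D.hasSimplicialVertices_fill hbag).hasEncodingOn (Nat.log 2 n) G Finset.univ
    D.le_fill (by rw [Finset.card_univ, hn]; omega)
  have hle : (G.pdim : ℝ) ≤ ((t + 2) * (Nat.log 2 n + 1) : ℕ) := by
    exact_mod_cast henc.pdim_le (by positivity)
  have hlog : (Nat.log 2 n : ℝ) ≤ Real.logb 2 n := by exact_mod_cast Real.natLog_le_logb n 2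
  refine hle.trans ?_
  push_cast
  gcongr
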